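/- Let $n,m\ge 1$ and $1\le k\le n$ be integers. In the $k$-Distinctness problem one is given an oracle $|i\rangle|y\rangle\mapsto|i\rangle|y\oplus A[i]\rangle$ (indices and values written in binary, $\oplus$ bitwise exclusive or) for an array $A$ with $n$ entries from $\{0,\ldots,m-1\}$, and one has to decide whether there are $k$ distinct indices at which $A$ takes identical values. There is an absolute constant $C>0$ such that for all such $n,m,k$ and every $\delta\in(0,\tfrac12]$ there is a quantum query algorithm (input-independent unitary operators on a fixed number of qubits, started in the all-zeros state and interleaved with oracle calls, followed by a measurement in the computational basis) that decides $k$-Distinctness on every such array with error probability at most $\delta$, using at most $C\,\frac{n^{3/2}}{\sqrt{k}}\log\!\big(\frac{n}{\delta k}\big)$ queries to the oracle and at most $C\,(\log m+\log n)\log\!\big(\frac{n}{\delta k}\big)$ qubits in total (including the qubits of the query registers). -/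

import Mathlib

namespace QuantumQuery

/-- Classical contents of a register of `a` qubits. -/
abbrev Bits (a : ℕ) : Type := Fin a → Bool

/-- Computational basis states of a machine that queries an array of `n` entries with values in
`{0, …, m - 1}`: an index register of `⌈log₂ n⌉` qubits, a value register of `⌈log₂ m⌉` qubits
and `w` further work qubits. -/
abbrev BasisState (n m w : ℕ) : Type :=
  Bits (Nat.clog 2 n) × Bits (Nat.clog 2 m) × Bits w

/-- The action of the oracle of the array `A` on basis states,
`|i⟩|y⟩|z⟩ ↦ |i⟩|y ⊕ A[i]⟩|z⟩`, where `⊕` is the bitwise exclusive or and integers are written in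
binary.  If the index register does not hold an index below `n`, nothing happens. -/
def queryMap {n m : ℕ} (A : Fin n → Fin m) (w : ℕ) (s : BasisState n m w) : BasisState n m w :=
  if h : Nat.ofBits s.1 < n then
    (s.1, fun t => xor (s.2.1 t) (Nat.testBit (A ⟨Nat.ofBits s.1, h⟩) t), s.2.2)
  else s

/-- The oracle of the array `A` as a matrix: the column of the basis state `s` is the basis vector
of `queryMap A w s`. -/
def oracle {n m : ℕ} (A : Fin n → Fin m) (w : ℕ) :
    Matrix (BasisState n m w) (BasisState n m w) ℂ :=
  Matrix.of fun s' s => if s' = queryMap A w s then 1 else 0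

/-- A quantum query algorithm for arrays of `n` entries with values in `{0, …, m - 1}`.  It starts
in the all-zeros state, applies `gate 0`, and then `queries` times the oracle followed by
the next one of its (input-independent) unitary operators `gate 1, …, gate queries`.  At the end
all qubits are measured in the computational basis, and the outcome decides the answer. -/
structure QueryAlgorithm (n m : ℕ) where
  /-- the number of qubits in addition to those of the index and value registers -/
  workQubits : ℕ
  /-- the number of calls of the oracle -/
  queries : ℕ
  /-- the unitary operators between the calls (only `gate 0, …, gate queries` are used) -/
  gate : ℕ → Matrix.unitaryGroup (BasisState n m workQubits) ℂ
  /-- the measurement outcomes on which the algorithm answers "yes" -/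
  accept : BasisState n m workQubits → Bool

namespace QueryAlgorithm

variable {n m : ℕ} (alg : QueryAlgorithm n m)

/-- The total number of qubits. -/
def qubits : ℕ := Nat.clog 2 n + Nat.clog 2 m + alg.workQubits

/-- The all-zeros basis state. -/
def zeroState : BasisState n m alg.workQubits :=
  (fun _ => false, fun _ => false, fun _ => false)

/-- The vector of amplitudes after `t` calls of the oracle of `A` and the operator that follows. -/
def stateAfter (A : Fin n → Fin m) : ℕ → BasisState n m alg.workQubits → ℂ
  | 0 => Matrix.mulVec (alg.gate 0 : Matrix _ _ ℂ) (Pi.single alg.zeroState 1)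
  | t + 1 => Matrix.mulVec (alg.gate (t + 1) : Matrix _ _ ℂ)
      (Matrix.mulVec (oracle A alg.workQubits) (stateAfter A t))

/-- The probability that the algorithm answers "yes" on the array `A`. -/
noncomputable def acceptProb (A : Fin n → Fin m) : ℝ :=
  ∑ s, if alg.accept s then ‖alg.stateAfter A alg.queries s‖ ^ 2 else 0

end QueryAlgorithm

/-- The array `A` has `k` distinct indices with identical values. -/
def HasEqualEntries {n m : ℕ} (k : ℕ) (A : Fin n → Fin m) : Prop :=
  ∃ S : Finset (Fin n), S.card = k ∧ ∀ i ∈ S, ∀ j ∈ S, A i = A j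

/-- On every array the algorithm decides `k`-Distinctness with error probability at most `δ`. -/
def QueryAlgorithm.SolvesDistinctness {n m : ℕ} (alg : QueryAlgorithm n m) (k : ℕ) (δ : ℝ) :
    Prop :=
  ∀ A : Fin n → Fin m,
    (HasEqualEntries k A → 1 - δ ≤ alg.acceptProb A) ∧
    (¬ HasEqualEntries k A → alg.acceptProb A ≤ δ)

end QuantumQuery

/-! Grover search over indices with a classical count as the checker. Prepare a uniform
superposition over the index register, read `A[x]`, and scan the whole array counting its
occurrences; this takes `2 * n + 1` queries (`exists_computes_search`). Accepting when the count is
at least `k` succeeds with probability at least `k / (2 * n)` on yes-instances and never on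
no-instances.

The number of suitable `x` is unknown, so the success probability is boosted by nested fixed-point
amplification (`Computes.exists_amplified`). One level costs a factor 3 in queries and no qubits,
and turns a rejection bound `1 / cosh² u` into `1 / cosh² (3 * u)`; success probability 0 stays 0.
Starting from `u = √(k / (2 * n))`, it suffices that `3 ^ i` is of order `√(n / k) * log (4 / δ)`.
-/

/-- The families `U : ι → G` of group elements that are products
`g t * O a * g (t - 1) * ⋯ * O a * g 0` with exactly `t` occurrences of the oracle `O a`. -/
inductive Computes {ι G : Type*} [Group G] (O : ι → G) : ℕ → (ι → G) → Prop
  | gate (g : G) : Computes O 0 fun _ => g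
  | query {t : ℕ} {U : ι → G} (g : G) (h : Computes O t U) :
      Computes O (t + 1) fun a => g * (O a * U a)

namespace Computes

variable {ι G : Type*} [Group G] {O : ι → G} {s t : ℕ} {U V : ι → G}

theorem gate_mul (g : G) (h : Computes O t U) : Computes O t fun a => g * U a := by
  cases h with
  | gate g' => exact .gate (g * g')
  | query g' h => simpa only [mul_assoc] using Computes.query (g * g') h

theorem mul (hU : Computes O s U) (hV : Computes O t V) :
    Computes O (s + t) fun a => U a * V a := by
  induction hU with
  | gate g => simpa using hV.gate_mul g
  | query g _ ih =>
    rw [add_right_comm]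
    simpa only [mul_assoc] using ih.query g

theorem oracle : Computes O 1 O := by
  simpa using (Computes.gate (O := O) 1).query 1

/-- Amplification runs circuits backwards; since the oracle is an involution, this needs no separate
inverse oracle. -/
theorem inv (hO : ∀ a, O a * O a = 1) (h : Computes O t U) :
    Computes O t fun a => (U a)⁻¹ := by
  induction h with
  | gate g => exact .gate g⁻¹
  | query g _ ih =>
    have h := (ih.mul oracle).mul (.gate g⁻¹)
    convert h using 2 with a
    rw [mul_inv_rev, mul_inv_rev, inv_eq_of_mul_eq_one_right (hO a)]

theorem exists_gates (h : Computes O t U) :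
    ∃ g : ℕ → G, ∀ a, ∃ u : ℕ → G, u 0 = g 0 ∧ (∀ i, u (i + 1) = g (i + 1) * (O a * u i)) ∧
      u t = U a := by
  -- Quantifying over every `u` that obeys the recursion below `t` lets the induction append a gate
  -- with `Function.update`.
  have key : ∃ g : ℕ → G, ∀ a, ∀ u : ℕ → G, u 0 = g 0 →
      (∀ i < t, u (i + 1) = g (i + 1) * (O a * u i)) → u t = U a := by
    induction h with
    | gate g => exact ⟨fun _ => g, fun a u h0 _ => h0⟩
    | @query t U g' _ ih =>
      obtain ⟨g, hg⟩ := ih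
      refine ⟨Function.update g (t + 1) g', fun a u h0 h1 => ?_⟩
      rw [h1 t t.lt_succ_self, Function.update_self, hg a u]
      · simpa using h0
      · intro i hi
        rw [h1 i (by omega), Function.update_of_ne (by omega)]
  obtain ⟨g, hg⟩ := key
  refine ⟨g, fun a => ⟨fun i => Nat.rec (g 0) (fun i u => g (i + 1) * (O a * u)) i,
    rfl, fun _ => rfl, hg a _ rfl fun _ _ => rfl⟩⟩

end Computes

/-! ### Unitary operators and amplitude amplification -/

section Unitary

open Matrix

variable {S : Type*} [Fintype S] [DecidableEq S]

/-- The unitary operator that permutes the basis states. -/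
def permUnitary : Equiv.Perm S →* unitaryGroup S ℂ where
  toFun σ := ⟨Matrix.of fun s' s => if s' = σ s then 1 else 0, by
    rw [mem_unitaryGroup_iff']
    ext i j
    by_cases h : i = j
    · subst h; simp [mul_apply]
    · simp [mul_apply, h, Ne.symm h]⟩
  map_one' := by
    refine Subtype.ext (Matrix.ext fun i j => ?_)
    change (if i = j then 1 else 0) = (1 : Matrix S S ℂ) i j
    rw [one_apply]
  map_mul' σ τ := by
    ext i j
    by_cases h : i = σ (τ j)
    · simp [mul_apply, h]
    · simp [mul_apply, h]

theorem permUnitary_apply (σ : Equiv.Perm S) (s' s : S) :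
    (permUnitary σ : Matrix S S ℂ) s' s = if s' = σ s then 1 else 0 := rfl

theorem permUnitary_mul_apply (σ : Equiv.Perm S) (U : unitaryGroup S ℂ) (s r : S) :
    ((permUnitary σ * U : unitaryGroup S ℂ) : Matrix S S ℂ) (σ s) r = (U : Matrix S S ℂ) s r := by
  simp [mul_apply, permUnitary_apply]

/-- The unitary operator that multiplies each basis state by a phase. -/
def phaseUnitary (d : S → ℂ) (hd : ∀ s, ‖d s‖ = 1) : unitaryGroup S ℂ :=
  ⟨Matrix.diagonal d, by
    rw [mem_unitaryGroup_iff', star_eq_conjTranspose, diagonal_conjTranspose, diagonal_mul_diagonal,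
      ← diagonal_one]
    congr 1
    funext s
    simp [Complex.conj_mul', hd]⟩

theorem sum_normSq_col_unitary (U : unitaryGroup S ℂ) (r : S) :
    ∑ s, ‖(U : Matrix S S ℂ) s r‖ ^ 2 = 1 := by
  have h := congrFun (congrFun (mem_unitaryGroup_iff'.1 U.2) r) r
  simp only [mul_apply, star_apply, RCLike.star_def, Complex.conj_mul', one_apply_eq] at h
  exact_mod_cast h

/-- Extend the unit vector `v` to an orthonormal basis; this supplies the state-preparation gate. -/
theorem exists_unitary_col (r : S) (v : S → ℂ) (hv : ∑ s, ‖v s‖ ^ 2 = 1) :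
    ∃ U : unitaryGroup S ℂ, ∀ s, (U : Matrix S S ℂ) s r = v s := by
  have hn : ‖WithLp.toLp 2 v‖ = 1 := by
    rw [EuclideanSpace.norm_eq]
    simp [hv]
  obtain ⟨b, hb⟩ := Orthonormal.exists_orthonormalBasis_extension_of_card_eq (𝕜 := ℂ)
    (E := EuclideanSpace ℂ S) (ι := S) (by simp) (v := fun _ => WithLp.toLp 2 v) (s := {r})
    ⟨fun _ => hn, fun i j hij => (hij (Subsingleton.elim _ _)).elim⟩
  refine ⟨⟨_, (EuclideanSpace.basisFun S ℂ).toMatrix_orthonormalBasis_mem_unitary b⟩, fun s => ?_⟩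
  simp [Module.Basis.toMatrix_apply, hb r rfl]

/-- The probability that the measurement of `U |r⟩` gives an outcome that is not accepted. -/
noncomputable def rejectProb (r : S) (acc : S → Bool) (U : unitaryGroup S ℂ) : ℝ :=
  ∑ s, if acc s then 0 else ‖(U : Matrix S S ℂ) s r‖ ^ 2

theorem rejectProb_nonneg (r : S) (acc : S → Bool) (U : unitaryGroup S ℂ) :
    0 ≤ rejectProb r acc U :=
  Finset.sum_nonneg fun s _ => by split_ifs <;> positivity

theorem sum_accept_eq (r : S) (acc : S → Bool) (U : unitaryGroup S ℂ) :
    (∑ s, if acc s then ‖(U : Matrix S S ℂ) s r‖ ^ 2 else 0) = 1 - rejectProb r acc U := by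
  rw [← sum_normSq_col_unitary U r, rejectProb, ← Finset.sum_sub_distrib]
  refine Finset.sum_congr rfl fun s _ => ?_
  split_ifs <;> simp

theorem norm_ite_phase {α : ℂ} (hα : ‖α‖ = 1) (b : Prop) [Decidable b] :
    ‖(if b then α else 1)‖ = 1 := by
  split_ifs <;> simp [hα]

/-- One step of amplitude amplification, with the same phase on the initial state and on the
accepted states. -/
noncomputable def amplify (r : S) (acc : S → Bool) (α : ℂ) (hα : ‖α‖ = 1)
    (U : unitaryGroup S ℂ) : unitaryGroup S ℂ :=
  U * (phaseUnitary (fun s => if s = r then α else 1) (fun _ => norm_ite_phase hα _) *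
    (U⁻¹ * (phaseUnitary (fun s => if acc s then α else 1) (fun _ => norm_ite_phase hα _) * U)))

/-- The phase on `r` is `1 + (α - 1)|r⟩⟨r|`. With `p` the success probability, `⟨r|U⁻¹TU|r⟩ = 1 + (α
- 1)p`, where `T` is the phase on accepted states. As `T` fixes rejected states, their amplitudes
all scale by `1 + (α - 1)(1 + (α - 1)p)`. -/
theorem amplify_apply (r : S) (acc : S → Bool) (α : ℂ) (hα : ‖α‖ = 1) (U : unitaryGroup S ℂ)
    (s : S) (hs : acc s = false) :
    (amplify r acc α hα U : Matrix S S ℂ) s r =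
      (α + (α - 1) ^ 2 * (1 - rejectProb r acc U : ℝ)) * (U : Matrix S S ℂ) s r := by
  set M : Matrix S S ℂ := (U : Matrix S S ℂ) with hM
  set T : Matrix S S ℂ := diagonal fun s => if acc s then α else 1 with hT
  have hdiag : (diagonal fun s => if s = r then α else 1) = 1 + (α - 1) • Matrix.single r r (1 : ℂ) := by
    ext i j
    by_cases hij : i = j
    · subst hij
      by_cases hi : i = r
      · subst hi; simp
      · simp [hi, Ne.symm hi]
    · simp only [diagonal_apply_ne _ hij, Matrix.add_apply, one_apply_ne hij, Matrix.smul_apply, single_apply]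
      rw [if_neg]
      · simp
      · rintro ⟨rfl, rfl⟩; exact hij rfl
  have hq : (star M * (T * M)) r r = 1 + (α - 1) * (1 - rejectProb r acc U : ℝ) := by
    have h1 : (1 : ℂ) = ∑ x, (‖M x r‖ ^ 2 : ℂ) := by
      exact_mod_cast (sum_normSq_col_unitary U r).symm
    rw [← sum_accept_eq, ← hM, mul_apply]
    simp only [hT, diagonal_mul, star_apply, RCLike.star_def]
    push_cast
    rw [Finset.mul_sum]
    nth_rewrite 2 [h1]
    rw [← Finset.sum_add_distrib]
    refine Finset.sum_congr rfl fun x _ => ?_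
    split_ifs
    · push_cast
      rw [← Complex.conj_mul']
      ring
    · push_cast
      rw [← Complex.conj_mul']
      ring
  have hV : (amplify r acc α hα U : Matrix S S ℂ) =
      T * M + (α - 1) • (M * (Matrix.single r r (1 : ℂ) * (star M * (T * M)))) := by
    have h1 : M * star M = 1 := mem_unitaryGroup_iff.1 U.2
    change M * ((diagonal fun s => if s = r then α else 1) * (star M * (T * M))) = _
    rw [hdiag, add_mul, mul_add, one_mul, ← mul_assoc M (star M), h1, one_mul, smul_mul_assoc,
      mul_smul_comm]
  rw [hV, Matrix.add_apply, Matrix.smul_apply, ← mul_assoc M, mul_apply (M := M * _), Finset.sum_eq_single r,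
    hq, hT, diagonal_mul]
  · simp [hs, mul_apply, Matrix.single_apply]
    ring
  · intro b _ hb
    simp [mul_apply, hb.symm]
  · simp

theorem rejectProb_amplify (r : S) (acc : S → Bool) (α : ℂ) (hα : ‖α‖ = 1)
    (U : unitaryGroup S ℂ) :
    rejectProb r acc (amplify r acc α hα U) =
      (1 - (2 - 2 * α.re) * (1 - rejectProb r acc U)) ^ 2 * rejectProb r acc U := by
  -- For unit `α` this makes the scaling factor a real number times a phase.
  have h1 : (α - 1) ^ 2 = α * (2 * α.re - 2 : ℝ) := by
    have h2 : α * (starRingEnd ℂ) α = 1 := by simp [Complex.mul_conj', hα]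
    have h3 : ((2 * α.re : ℝ) : ℂ) = α + (starRingEnd ℂ) α := (Complex.add_conj α).symm
    rw [Complex.ofReal_sub, h3]
    push_cast
    linear_combination -h2
  have h4 : ∀ s, acc s = false → ‖(amplify r acc α hα U : Matrix S S ℂ) s r‖ ^ 2 =
      (1 - (2 - 2 * α.re) * (1 - rejectProb r acc U)) ^ 2 * ‖(U : Matrix S S ℂ) s r‖ ^ 2 := by
    intro s hs
    have h5 : α + (α - 1) ^ 2 * (1 - rejectProb r acc U : ℝ) =
        α * (1 - (2 - 2 * α.re) * (1 - rejectProb r acc U) : ℝ) := by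
      rw [h1]; push_cast; ring
    rw [amplify_apply r acc α hα U s hs, h5, norm_mul, norm_mul, hα, one_mul, mul_pow,
      Complex.norm_real, Real.norm_eq_abs, sq_abs]
  rw [rejectProb, rejectProb, Finset.mul_sum]
  refine Finset.sum_congr rfl fun s _ => ?_
  by_cases hs : acc s
  · simp [hs]
  · have hs' : acc s = false := by simpa using hs
    simp only [hs', Bool.false_eq_true, if_false]
    exact h4 s hs'

theorem exists_phase (c : ℝ) (h1 : -1 ≤ c) (h2 : c ≤ 1) : ∃ α : ℂ, ‖α‖ = 1 ∧ α.re = c :=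
  ⟨Complex.exp (Real.arccos c * Complex.I), Complex.norm_exp_ofReal_mul_I _, by
    rw [Complex.exp_ofReal_mul_I_re, Real.cos_arccos h1 h2]⟩

end Unitary

/-- Fixed-point amplitude amplification: `3 ^ i` uses of a family of unitary operators whose success
probability is either `0` or at least `1 - 1 / cosh² u` yield one whose success probability
is `0` or at least `1 - 1 / cosh² (3 ^ i * u)`, respectively. -/
theorem Computes.exists_amplified {ι S : Type*} [Fintype S] [DecidableEq S]
    {O : ι → Matrix.unitaryGroup S ℂ} (hO : ∀ a, O a * O a = 1) {t : ℕ}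
    {U : ι → Matrix.unitaryGroup S ℂ} (hU : Computes O t U) (r : S) (acc : S → Bool) (u : ℝ)
    (i : ℕ) :
    ∃ V, Computes O (3 ^ i * t) V ∧ ∀ a,
      (rejectProb r acc (U a) = 1 → rejectProb r acc (V a) = 1) ∧
      (rejectProb r acc (U a) * Real.cosh u ^ 2 ≤ 1 →
        rejectProb r acc (V a) * Real.cosh (3 ^ i * u) ^ 2 ≤ 1) := by
  induction i with
  | zero => exact ⟨U, by simpa using hU, fun a => ⟨id, by simp⟩⟩
  | succ i ih =>
    obtain ⟨V, hV, hr⟩ := ih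
    set Y := Real.cosh (3 ^ i * u) ^ 2 with hY
    have hY1 : 1 ≤ Y := one_le_pow₀ (Real.one_le_cosh _)
    have hpos : 0 < 4 * Y - 3 := by linarith
    -- With this phase the new rejection probability `ε'` satisfies `ε' * (4 * Y - 3) ^ 2 = (4 * ε *
    -- Y - 3) ^ 2 * ε`, matching `cosh (3x) = 4 cosh³ x - 3 cosh x`. The real part is at least `-1`
    -- because `Y ≥ 1`.
    obtain ⟨α, hα, hre⟩ := exists_phase (1 - 2 * Y / (4 * Y - 3))
      (by
        rw [neg_le_sub_iff_le_add, div_le_iff₀ hpos]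
        linarith)
      (by have : 0 ≤ 2 * Y / (4 * Y - 3) := by positivity
          linarith)
    refine ⟨fun a => amplify r acc α hα (V a), ?_, fun a => ?_⟩
    · have h := hV.mul ((Computes.gate (phaseUnitary (fun s => if s = r then α else 1)
        (fun _ => norm_ite_phase hα _))).mul ((hV.inv hO).mul ((Computes.gate
        (phaseUnitary (fun s => if acc s then α else 1) (fun _ => norm_ite_phase hα _))).mul hV)))
      have e : 3 ^ i * t + (0 + (3 ^ i * t + (0 + 3 ^ i * t))) = 3 ^ (i + 1) * t := by ring
      exact e ▸ h
    · have hY' : Real.cosh (3 ^ (i + 1) * u) ^ 2 = Y * (4 * Y - 3) ^ 2 := by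
        rw [pow_succ' 3, mul_assoc, Real.cosh_three_mul, hY]
        ring
      obtain ⟨h0, h1⟩ := hr a
      have h2 : rejectProb r acc (amplify r acc α hα (V a)) * (4 * Y - 3) ^ 2 =
          (4 * (rejectProb r acc (V a) * Y) - 3) ^ 2 * rejectProb r acc (V a) := by
        rw [rejectProb_amplify, hre]
        have h3 : (1 - (2 - 2 * (1 - 2 * Y / (4 * Y - 3))) * (1 - rejectProb r acc (V a))) *
            (4 * Y - 3) = 4 * (rejectProb r acc (V a) * Y) - 3 := by
          have hne : 4 * Y - 3 ≠ 0 := hpos.ne'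
          linear_combination (4 * (1 - rejectProb r acc (V a))) * (-(div_mul_cancel₀ Y hne))
        rw [mul_right_comm, ← mul_pow, h3]
      refine ⟨fun h => ?_, fun h => ?_⟩
      · rw [rejectProb_amplify, h0 h]
        simp
      · rw [hY']
        have hz := h1 h
        have hz0 : 0 ≤ rejectProb r acc (V a) * Y :=
          mul_nonneg (rejectProb_nonneg _ _ _) (by linarith)
        set z := rejectProb r acc (V a) * Y with hzdef
        have : rejectProb r acc (amplify r acc α hα (V a)) * (Y * (4 * Y - 3) ^ 2) =
            (4 * z - 3) ^ 2 * z := by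
          rw [mul_left_comm, h2, hzdef]; ring
        rw [this]
        -- Uses `1 - z * (4z - 3)² = (1 - z) * (4z - 1)²`, the bound on the squared Chebyshev
        -- polynomial `T₃(√z)²`.
        nlinarith [mul_nonneg (sub_nonneg.2 hz) (sq_nonneg (4 * z - 1))]

/-! ### The oracle as a permutation, and running computed families -/

namespace QuantumQuery

theorem lt_two_pow_clog {n : ℕ} (j : Fin n) : (j : ℕ) < 2 ^ Nat.clog 2 n :=
  j.2.trans_le (Nat.le_pow_clog one_lt_two n)

/-- The contents of a register that holds `0`. -/
def zeroBits {a : ℕ} : Bits a := fun _ => false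

/-- The binary digits of a number below `n`. -/
def toBits {n : ℕ} (j : Fin n) : Bits (Nat.clog 2 n) := fun t => Nat.testBit j t

theorem ofBits_toBits {n : ℕ} (j : Fin n) : Nat.ofBits (toBits j) = j := by
  unfold toBits
  rw [Nat.ofBits_testBit, Nat.mod_eq_of_lt (lt_two_pow_clog j)]

theorem toBits_injective {n : ℕ} : Function.Injective (toBits (n := n)) := fun i j h =>
  Fin.ext (by rw [← ofBits_toBits i, h, ofBits_toBits])

variable {n m w : ℕ}

theorem queryMap_toBits (A : Fin n → Fin m) (j : Fin n) (y : Bits (Nat.clog 2 m)) (z : Bits w) :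
    queryMap A w (toBits j, y, z) = (toBits j, fun t => xor (y t) (toBits (A j) t), z) := by
  have h : (⟨Nat.ofBits (toBits j), (ofBits_toBits j).trans_lt j.2⟩ : Fin n) = j :=
    Fin.ext (ofBits_toBits j)
  rw [queryMap, dif_pos ((ofBits_toBits j).trans_lt j.2)]
  simp only [h]
  rfl

theorem queryMap_involutive (A : Fin n → Fin m) (w : ℕ) : Function.Involutive (queryMap A w) := by
  intro s
  by_cases h : Nat.ofBits s.1 < n
  · simp [queryMap, h]
  · simp [queryMap, h]

/-- The oracle as a permutation of the basis states. -/
def queryPerm (w : ℕ) (A : Fin n → Fin m) : Equiv.Perm (BasisState n m w) :=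
  (queryMap_involutive A w).toPerm

theorem permUnitary_queryPerm (w : ℕ) (A : Fin n → Fin m) :
    (permUnitary (queryPerm w A) : Matrix _ _ ℂ) = oracle A w := rfl

/-- A computed family of unitary operators is run by a query algorithm. -/
theorem exists_queryAlgorithm {t : ℕ}
    {U : (Fin n → Fin m) → Matrix.unitaryGroup (BasisState n m w) ℂ}
    (hU : Computes (fun A => permUnitary (queryPerm w A)) t U) (acc : BasisState n m w → Bool) :
    ∃ alg : QueryAlgorithm n m, alg.workQubits = w ∧ alg.queries = t ∧ ∀ A, alg.acceptProb A =
      1 - rejectProb ((zeroBits, zeroBits, zeroBits) : BasisState n m w) acc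
        (U A) := by
  obtain ⟨g, hg⟩ := hU.exists_gates
  refine ⟨⟨w, t, g, acc⟩, rfl, rfl, fun A => ?_⟩
  obtain ⟨u, h0, h1, h2⟩ := hg A
  rw [← sum_accept_eq, QueryAlgorithm.acceptProb]
  have key : ∀ i, (⟨w, t, g, acc⟩ : QueryAlgorithm n m).stateAfter A i =
      Matrix.mulVec (u i : Matrix _ _ ℂ) (Pi.single ((zeroBits, zeroBits, zeroBits) : BasisState n m w) 1) := by
    intro i
    induction i with
    | zero => rw [h0]; rfl
    | succ i ih =>
      rw [QueryAlgorithm.stateAfter, ih, h1, Matrix.mulVec_mulVec, Matrix.mulVec_mulVec]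
      simp only [Submonoid.coe_mul, permUnitary_queryPerm, mul_assoc]
  refine Finset.sum_congr rfl fun s _ => ?_
  rw [key, h2, Matrix.mulVec_single_one]
  rfl

/-- Classical contents of the work registers of the counting circuit: a stored index, a stored value
and a counter. -/
abbrev CountWork (n m c : ℕ) : Type :=
  Bits (Nat.clog 2 n) × Bits (Nat.clog 2 m) × ZMod (2 ^ c)

/-- The number of indices below `t` at which the array holds the value with binary digits `v`. -/
def countBelow (A : Fin n → Fin m) (v : Bits (Nat.clog 2 m)) (t : ℕ) : ℕ :=
  (Finset.univ.filter fun j : Fin n => j < t ∧ toBits (A j) = v).card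

theorem countBelow_succ (A : Fin n → Fin m) (v : Bits (Nat.clog 2 m)) (t : ℕ) (ht : t < n) :
    countBelow A v (t + 1) = countBelow A v t + if toBits (A ⟨t, ht⟩) = v then 1 else 0 := by
  have hs : (Finset.univ.filter fun j : Fin n => (j : ℕ) < t + 1 ∧ toBits (A j) = v) =
      (Finset.univ.filter fun j : Fin n => (j : ℕ) < t ∧ toBits (A j) = v) ∪
        if toBits (A ⟨t, ht⟩) = v then {⟨t, ht⟩} else ∅ := by
    ext j
    by_cases hj : j = ⟨t, ht⟩
    · subst hj; split_ifs with hv <;> simp [hv]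
    · have h1 : (j : ℕ) ≠ t := fun h => hj (Fin.ext h)
      have h2 : (j : ℕ) ≤ t ↔ (j : ℕ) < t := by omega
      split_ifs <;> simp [hj, h2]
  rw [countBelow, hs, Finset.card_union_of_disjoint]
  · split_ifs <;> simp [countBelow]
  · split_ifs <;> simp

theorem countBelow_self (A : Fin n → Fin m) (v : Bits (Nat.clog 2 m)) :
    countBelow A v n = (Finset.univ.filter fun j : Fin n => toBits (A j) = v).card := by
  simp [countBelow]

/-! ### The reversible counting circuit -/

section Counting

variable {c : ℕ} (e : CountWork n m c ≃ Bits w)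

/-- Exchanges the index and value registers with the stored index and value. -/
def storePerm : Equiv.Perm (BasisState n m w) :=
  Function.Involutive.toPerm (fun s => ((e.symm s.2.2).1, (e.symm s.2.2).2.1,
    e (s.1, s.2.1, (e.symm s.2.2).2.2))) fun s => by simp

/-- Exchanges two contents of the index register. -/
def indexSwap (i j : Bits (Nat.clog 2 n)) : Equiv.Perm (BasisState n m w) :=
  (Equiv.swap i j).prodCongr (Equiv.refl _)

/-- Increments the counter if the value register holds the stored value. -/
def incrPerm : Equiv.Perm (BasisState n m w) where
  toFun s := (s.1, s.2.1, e ((e.symm s.2.2).1, (e.symm s.2.2).2.1,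
    (e.symm s.2.2).2.2 + if s.2.1 = (e.symm s.2.2).2.1 then 1 else 0))
  invFun s := (s.1, s.2.1, e ((e.symm s.2.2).1, (e.symm s.2.2).2.1,
    (e.symm s.2.2).2.2 - if s.2.1 = (e.symm s.2.2).2.1 then 1 else 0))
  left_inv s := by simp
  right_inv s := by simp

/-- Load `A[j]`, compare and increment, then query again to clear the value register: hence two
queries. -/
theorem computes_count_step (j : Fin n) :
    ∃ σ : (Fin n → Fin m) → Equiv.Perm (BasisState n m w),
      Computes (queryPerm w) 2 σ ∧ ∀ A x v z,
        σ A (zeroBits, zeroBits, e (x, v, z)) =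
          (zeroBits, zeroBits, e (x, v, z + if toBits (A j) = v then 1 else 0)) := by
  refine ⟨_, (((Computes.gate (indexSwap (zeroBits) (toBits j))).query
    (incrPerm e)).query (indexSwap (zeroBits) (toBits j))), fun A x v z => ?_⟩
  have h1 : indexSwap (m := m) (w := w) (zeroBits) (toBits j)
      (zeroBits, zeroBits, e (x, v, z)) =
      (toBits j, zeroBits, e (x, v, z)) := by simp [indexSwap]
  have h2 : ∀ z, queryPerm w A (toBits j, zeroBits, z) = (toBits j, toBits (A j), z) := fun z =>
    (queryMap_toBits A j zeroBits z).trans (by simp [zeroBits])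
  have h3 : ∀ z, queryPerm w A (toBits j, toBits (A j), z) = (toBits j, zeroBits, z) := fun z =>
    (queryMap_toBits A j (toBits (A j)) z).trans (by simp; rfl)
  simp only [Equiv.Perm.mul_apply, h1, h2]
  simp [incrPerm, h3, indexSwap]

theorem computes_count (t : ℕ) (ht : t ≤ n) :
    ∃ σ : (Fin n → Fin m) → Equiv.Perm (BasisState n m w),
      Computes (queryPerm w) (2 * t) σ ∧ ∀ A x v,
        σ A (zeroBits, zeroBits, e (x, v, 0)) =
          (zeroBits, zeroBits,
            e (x, v, countBelow A v t)) := by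
  induction t with
  | zero => exact ⟨_, .gate 1, by simp [countBelow]⟩
  | succ t ih =>
    obtain ⟨σ, hσ, h⟩ := ih (by omega)
    obtain ⟨τ, hτ, h'⟩ := computes_count_step e (⟨t, ht⟩ : Fin n)
    refine ⟨_, by simpa [mul_add, add_comm] using hτ.mul hσ, fun A x v => ?_⟩
    rw [Equiv.Perm.mul_apply, h, h']
    rw [countBelow_succ A v t ht]
    push_cast
    rfl

theorem computes_count_index (e : CountWork n m c ≃ Bits w) :
    ∃ σ : (Fin n → Fin m) → Equiv.Perm (BasisState n m w),
      Computes (queryPerm w) (2 * n + 1) σ ∧ ∀ A x, ∃ v,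
        σ A (x, zeroBits, e (zeroBits, zeroBits, 0)) =
          (zeroBits, zeroBits,
            e (x, v, countBelow A v n)) ∧
        ∀ i, x = toBits i → v = toBits (A i) := by
  obtain ⟨σ, hσ, h⟩ := computes_count e n le_rfl
  refine ⟨_, hσ.mul ((Computes.gate 1).query (storePerm e)), fun A x => ?_⟩
  -- If `x` encodes no index, the oracle does nothing and `v` is zero; the circuit still counts
  -- genuine occurrences of `v`, so it remains sound.
  set v := (queryMap A w (x, zeroBits, e (zeroBits, zeroBits, 0))).2.1 with hv
  have hq : queryPerm w A (x, zeroBits, e (zeroBits, zeroBits, 0)) =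
      (x, v, e (zeroBits, zeroBits, 0)) := by
    change queryMap A w _ = _
    rw [hv, queryMap]
    split_ifs <;> rfl
  refine ⟨v, ?_, ?_⟩
  · have hst : storePerm e (x, v, e (zeroBits, zeroBits, 0)) =
        (zeroBits, zeroBits, e (x, v, 0)) := by
      refine (congrFun (Function.Involutive.coe_toPerm _) _).trans ?_
      simp
    simp only [Equiv.Perm.mul_apply, Equiv.Perm.one_apply, hq, hst, h]
  · rintro i rfl
    rw [hv, queryMap_toBits]
    simp [zeroBits]

end Counting

theorem hasEqualEntries_of_le_count {k : ℕ} (A : Fin n → Fin m) (v : Bits (Nat.clog 2 m))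
    (h : k ≤ countBelow A v n) : HasEqualEntries k A := by
  rw [countBelow_self] at h
  obtain ⟨S, hS, hc⟩ := Finset.exists_subset_card_eq h
  refine ⟨S, hc, fun i hi j hj => toBits_injective ?_⟩
  rw [(Finset.mem_filter.1 (hS hi)).2, (Finset.mem_filter.1 (hS hj)).2]

theorem le_count_of_mem {k : ℕ} (A : Fin n → Fin m) {S : Finset (Fin n)} (hc : S.card = k)
    (hS : ∀ i ∈ S, ∀ j ∈ S, A i = A j) {i : Fin n} (hi : i ∈ S) :
    k ≤ countBelow A (toBits (A i)) n := by
  rw [countBelow_self, ← hc]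
  exact Finset.card_le_card fun j hj => by simp [hS j hj i hi]

end QuantumQuery

/-- Transports the counting circuit from permutations to unitaries along `permUnitary`. -/
theorem Computes.map {ι G H : Type*} [Group G] [Group H] {O : ι → G} {t : ℕ} {U : ι → G}
    (f : G →* H) (h : Computes O t U) : Computes (fun a => f (O a)) t fun a => f (U a) := by
  induction h with
  | gate g => exact .gate (f g)
  | query g _ ih => simpa only [map_mul] using ih.query (f g)

/-! ### The search operator and its success probability -/

namespace QuantumQuery

variable {n m : ℕ}

theorem two_pow_clog_le (hn : 1 ≤ n) : 2 ^ Nat.clog 2 n ≤ 2 * n := by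
  rcases hn.eq_or_lt with rfl | hn
  · simp
  · have h := Nat.pow_pred_clog_lt_self one_lt_two hn
    have h0 : 0 < Nat.clog 2 n := Nat.clog_pos one_lt_two hn
    rw [← Nat.succ_pred_eq_of_pos h0, pow_succ]
    omega

theorem rejectProb_perm_mul_uniform {w : ℕ} (r : BasisState n m w) (acc : BasisState n m w → Bool)
    (G : Matrix.unitaryGroup (BasisState n m w) ℂ) (z : Bits (Nat.clog 2 m) × Bits w)
    (hG : ∀ s : BasisState n m w, (G : Matrix (BasisState n m w) (BasisState n m w) ℂ) s r =
      if s.2 = z then ((√((2 : ℝ) ^ Nat.clog 2 n)⁻¹ : ℝ) : ℂ) else 0)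
    (σ : Equiv.Perm (BasisState n m w)) :
    rejectProb r acc (permUnitary σ * G) =
      1 - ((Finset.univ.filter fun x => acc (σ (x, z)) = true).card : ℝ) *
        ((2 : ℝ) ^ Nat.clog 2 n)⁻¹ := by
  rw [eq_sub_iff_add_eq', ← eq_sub_iff_add_eq, ← sum_accept_eq, ← Equiv.sum_comp σ]
  simp only [permUnitary_mul_apply, hG]
  rw [Fintype.sum_prod_type, ← nsmul_eq_mul, ← Finset.sum_const, Finset.sum_filter]
  refine Finset.sum_congr rfl fun x _ => ?_
  rw [Finset.sum_eq_single z]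
  · simp only [if_true, Complex.norm_real, Real.norm_eq_abs, sq_abs]
    rw [Real.sq_sqrt (by positivity)]
  · intro b _ hb
    simp [hb]
  · simp

/-- Classical counting of the occurrences of `A[x]` for `x` in uniform superposition. -/
theorem exists_computes_search (n m k : ℕ) (hn : 1 ≤ n) :
    ∃ (w : ℕ) (acc : BasisState n m w → Bool)
      (U : (Fin n → Fin m) → Matrix.unitaryGroup (BasisState n m w) ℂ),
      w ≤ 2 * Nat.clog 2 n + Nat.clog 2 m + 1 ∧
      Computes (fun A => permUnitary (queryPerm w A)) (2 * n + 1) U ∧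
      ∀ A, (¬ HasEqualEntries k A → rejectProb (zeroBits, zeroBits, zeroBits) acc (U A) = 1) ∧
        (HasEqualEntries k A →
          rejectProb (zeroBits, zeroBits, zeroBits) acc (U A) ≤ 1 - k / (2 * n)) := by
  set c := Nat.clog 2 n + 1 with hc
  -- The extra counter bit lets counts up to `n` fit without wrapping around.
  have hnc : n < 2 ^ c := by
    have := Nat.le_pow_clog one_lt_two n
    rw [hc, pow_succ]
    omega
  -- Any bijection serves as encoding: the preparation gate `G` loads the encoded zeros, which need
  -- not be the zero string.
  let e : CountWork n m c ≃ Bits (Nat.clog 2 n + Nat.clog 2 m + c) :=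
    Fintype.equivOfCardEq (by simp [ZMod.card, pow_add, mul_assoc])
  obtain ⟨σ, hσ, hσA⟩ := computes_count_index e
  let z : Bits (Nat.clog 2 m) × Bits (Nat.clog 2 n + Nat.clog 2 m + c) :=
    (zeroBits, e (zeroBits, zeroBits, 0))
  obtain ⟨G, hG⟩ := exists_unitary_col
    ((zeroBits, zeroBits, zeroBits) : BasisState n m (Nat.clog 2 n + Nat.clog 2 m + c))
    (fun s => if s.2 = z then ((√((2 : ℝ) ^ Nat.clog 2 n)⁻¹ : ℝ) : ℂ) else 0) (by
      rw [Fintype.sum_prod_type]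
      have h : ∀ x : Bits (Nat.clog 2 n),
          ∑ y, ‖if y = z then ((√((2 : ℝ) ^ Nat.clog 2 n)⁻¹ : ℝ) : ℂ) else 0‖ ^ 2 =
            ((2 : ℝ) ^ Nat.clog 2 n)⁻¹ := fun x => by
        rw [Finset.sum_eq_single z]
        · simp only [if_true, Complex.norm_real, Real.norm_eq_abs, sq_abs]
          rw [Real.sq_sqrt (by positivity)]
        · intro b _ hb
          simp [hb]
        · simp
      rw [Finset.sum_congr rfl fun x _ => h x]
      simp)
  refine ⟨Nat.clog 2 n + Nat.clog 2 m + c, fun s => decide (k ≤ (e.symm s.2.2).2.2.val),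
    fun A => permUnitary (σ A) * G, by omega, (hσ.map permUnitary).mul (.gate G), fun A => ?_⟩
  rw [rejectProb_perm_mul_uniform _ _ G z hG]
  have hacc : ∀ x, ∃ v, (k ≤ (e.symm (σ A (x, z)).2.2).2.2.val ↔ k ≤ countBelow A v n) ∧
      ∀ i, x = toBits i → v = toBits (A i) := by
    intro x
    obtain ⟨v, h1, h2⟩ := hσA A x
    refine ⟨v, ?_, h2⟩
    have h3 : countBelow A v n < 2 ^ c :=
      ((Finset.card_le_univ _).trans_eq (Fintype.card_fin n)).trans_lt hnc
    rw [h1, Equiv.symm_apply_apply, ZMod.val_natCast_of_lt h3]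
  refine ⟨fun h => ?_, fun ⟨S, hS, hA⟩ => ?_⟩
  · rw [Finset.filter_false_of_mem]
    · simp
    · intro x _ hx
      obtain ⟨v, hv, -⟩ := hacc x
      exact h (hasEqualEntries_of_le_count A v (hv.1 (of_decide_eq_true hx)))
  -- All `k` indices in `S` are accepted, among at most `2 * n` contents of the index register.
  · have h1 : k ≤ (Finset.univ.filter fun x =>
        decide (k ≤ (e.symm (σ A (x, z)).2.2).2.2.val) = true).card := by
      refine (hS.symm.trans (Finset.card_image_of_injective S toBits_injective).symm).trans_le
        (Finset.card_le_card fun x hx => ?_)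
      obtain ⟨i, hi, rfl⟩ := Finset.mem_image.1 hx
      obtain ⟨v, hv, hv'⟩ := hacc (toBits i)
      rw [Finset.mem_filter, decide_eq_true_iff, hv, hv' i rfl]
      exact ⟨Finset.mem_univ _, le_count_of_mem A hS hA hi⟩
    have h2 : ((2 : ℝ) ^ Nat.clog 2 n) ≤ 2 * n := by exact_mod_cast two_pow_clog_le hn
    rw [div_eq_mul_inv]
    gcongr

theorem clog_mul_log_two_le (hn : 1 ≤ n) : (Nat.clog 2 n : ℝ) * Real.log 2 ≤ 2 * Real.log n := by
  rcases hn.eq_or_lt with rfl | hn'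
  · simp
  · have h : ((2 : ℝ) ^ Nat.clog 2 n) ≤ 2 * n := by exact_mod_cast two_pow_clog_le hn
    have h2 := Real.log_le_log (by positivity) h
    rw [Real.log_pow, Real.log_mul two_ne_zero (by positivity)] at h2
    have h3 : Real.log 2 ≤ Real.log n := Real.log_le_log two_pos (by exact_mod_cast hn')
    linarith

end QuantumQuery

/-- This is `tanh u ≤ u`, squared; it puts the initial rejection bound `1 - u²` into the form that
amplification expects. -/
theorem one_sub_sq_mul_cosh_sq_le {u : ℝ} (hu : 0 ≤ u) : (1 - u ^ 2) * Real.cosh u ^ 2 ≤ 1 := by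
  have h : Real.sinh u ≤ u * Real.cosh u := by
    have hmono : MonotoneOn (fun x => x * Real.cosh x - Real.sinh x) (Set.Ici 0) := by
      refine monotoneOn_of_deriv_nonneg (convex_Ici 0) (by fun_prop) (by fun_prop) fun x hx => ?_
      have hd : HasDerivAt (fun x => x * Real.cosh x - Real.sinh x)
          (1 * Real.cosh x + x * Real.sinh x - Real.cosh x) x :=
        ((hasDerivAt_id x).mul (Real.hasDerivAt_cosh x)).sub (Real.hasDerivAt_sinh x)
      rw [hd.deriv]
      rw [interior_Ici] at hx
      have : 0 ≤ x * Real.sinh x := mul_nonneg (le_of_lt hx) (Real.sinh_nonneg_iff.2 (le_of_lt hx))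
      linarith
    simpa using hmono Set.self_mem_Ici hu hu
  have h2 := pow_le_pow_left₀ (Real.sinh_nonneg_iff.2 hu) h 2
  have h3 := Real.cosh_sq u
  nlinarith

open QuantumQuery in
-- The condition on `i` makes `cosh² (3 ^ i * u) ≥ exp (2 * 3 ^ i * u) / 4 ≥ 1 / δ`.
theorem exists_queryAlgorithm_of_pow (n m k i : ℕ) (δ : ℝ) (hn : 1 ≤ n) (hδ : 0 < δ)
    (hi : Real.log (4 / δ) ≤ 2 * (3 ^ i * √(k / (2 * n)))) :
    ∃ alg : QueryAlgorithm n m, alg.SolvesDistinctness k δ ∧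
      alg.queries = 3 ^ i * (2 * n + 1) ∧
      alg.qubits ≤ 3 * Nat.clog 2 n + 2 * Nat.clog 2 m + 1 := by
  obtain ⟨w, acc, U, hw, hU, hr⟩ := exists_computes_search n m k hn
  obtain ⟨V, hV, hVr⟩ := hU.exists_amplified (fun A => by
      rw [← map_mul, show queryPerm w A * queryPerm w A = 1 from
        Equiv.ext (queryMap_involutive A w), map_one])
    (zeroBits, zeroBits, zeroBits) acc √(k / (2 * n)) i
  obtain ⟨alg, hwork, hq, hacc⟩ := exists_queryAlgorithm hV acc
  refine ⟨alg, fun A => ?_, hq, by rw [QueryAlgorithm.qubits, hwork]; omega⟩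
  rw [hacc]
  refine ⟨fun h => ?_, fun h => ?_⟩
  · set u := √((k : ℝ) / (2 * n)) with hu
    have h1 : rejectProb (zeroBits, zeroBits, zeroBits) acc (U A) * Real.cosh u ^ 2 ≤ 1 := by
      refine le_trans ?_ (one_sub_sq_mul_cosh_sq_le (Real.sqrt_nonneg (k / (2 * n) : ℝ)))
      rw [Real.sq_sqrt (by positivity)]
      exact mul_le_mul_of_nonneg_right ((hr A).2 h) (by positivity)
    have h2 := (hVr A).2 h1
    have h3 : 1 / δ ≤ Real.cosh (3 ^ i * u) ^ 2 := by
      have h4 : Real.exp (3 ^ i * u) / 2 ≤ Real.cosh (3 ^ i * u) := by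
        rw [Real.cosh_eq]
        have := Real.exp_pos (-(3 ^ i * u))
        linarith
      have h5 := pow_le_pow_left₀ (by positivity) h4 2
      have h6 := (Real.log_le_iff_le_exp (by positivity)).1 hi
      rw [two_mul, Real.exp_add] at h6
      have h7 : 4 / δ = 4 * (1 / δ) := by ring
      nlinarith
    have h8 := mul_le_mul_of_nonneg_left h3
      (rejectProb_nonneg (zeroBits, zeroBits, zeroBits) acc (V A))
    have h9 := h8.trans h2
    rw [mul_one_div, div_le_one hδ] at h9
    linarith
  · rw [(hVr A).1 ((hr A).1 h)]
    linarith

theorem exists_three_pow_near {x : ℝ} (hx : 1 ≤ x) : ∃ i : ℕ, x ≤ 3 ^ i ∧ (3 : ℝ) ^ i ≤ 3 * x := by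
  obtain ⟨j, h1, h2⟩ := exists_nat_pow_near hx (by norm_num : (1 : ℝ) < 3)
  exact ⟨j + 1, h2.le, by rw [pow_succ']; linarith⟩

open QuantumQuery in
theorem mainTheorem7 :
    ∃ C : ℝ, 0 < C ∧
      ∀ (n m k : ℕ) (δ : ℝ), 1 ≤ m → 1 ≤ k → k ≤ n → 0 < δ → δ ≤ 1 / 2 →
        ∃ alg : QuantumQuery.QueryAlgorithm n m,
          alg.SolvesDistinctness k δ ∧
          (alg.queries : ℝ) ≤
            C * ((n : ℝ) ^ (3 / 2 : ℝ) / Real.sqrt (k : ℝ) * Real.log ((n : ℝ) / (δ * (k : ℝ)))) ∧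
          (alg.qubits : ℝ) ≤
            C * ((Real.log (m : ℝ) + Real.log (n : ℝ)) * Real.log ((n : ℝ) / (δ * (k : ℝ)))) := by
  refine ⟨100, by norm_num, fun n m k δ hm hk hkn hδ hδ2 => ?_⟩
  have hn : 1 ≤ n := hk.trans hkn
  have hk0 : (0 : ℝ) < k := by exact_mod_cast hk
  have hn0 : (0 : ℝ) < n := by exact_mod_cast hn
  have hkn' : (k : ℝ) ≤ n := by exact_mod_cast hkn
  set R := Real.log ((n : ℝ) / (δ * (k : ℝ))) with hR
  have hl2 : 0.6931471803 < Real.log 2 := Real.log_two_gt_d9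
  have hδR : Real.log (1 / δ) ≤ R := by
    refine Real.log_le_log (by positivity) ?_
    rw [div_le_div_iff₀ hδ (by positivity)]
    nlinarith
  have hδ2' : Real.log 2 ≤ Real.log (1 / δ) :=
    Real.log_le_log two_pos (by rw [le_div_iff₀ hδ]; linarith)
  have hcm := clog_mul_log_two_le hm
  have hcn := clog_mul_log_two_le hn
  have hlm : 0 ≤ Real.log m := Real.log_natCast_nonneg m
  have hln : 0 ≤ Real.log n := Real.log_natCast_nonneg n
  have hqub : ∀ q : ℕ, (q : ℝ) * Real.log 2 ≤ 10 * (Real.log m + Real.log n) →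
      (q : ℝ) ≤ 100 * ((Real.log m + Real.log n) * R) := by
    intro q hq
    have h1 : (q : ℝ) ≤ 20 * (Real.log m + Real.log n) := by
      have : (q : ℝ) * 0.5 ≤ q * Real.log 2 :=
        mul_le_mul_of_nonneg_left (by linarith) (Nat.cast_nonneg q)
      linarith
    have h2 : (Real.log m + Real.log n) * 0.5 ≤ (Real.log m + Real.log n) * R :=
      mul_le_mul_of_nonneg_left (by linarith) (by linarith)
    linarith
  -- For `n = 1` the qubit bound can be 0 (when `m = 1`), leaving no room for work qubits; but then
  -- `k = 1` and the answer is always yes.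
  rcases hn.eq_or_lt with rfl | hn2
  · obtain rfl : k = 1 := by omega
    obtain ⟨alg, hw, hq, hacc⟩ := exists_queryAlgorithm (n := 1) (m := m) (w := 0)
      (.gate 1) fun _ => true
    refine ⟨alg, fun A => ?_, ?_, hqub _ ?_⟩
    · rw [hacc]
      refine ⟨fun _ => by simp [rejectProb, hδ.le], fun h => (h ?_).elim⟩
      exact ⟨{0}, by simp, by simp⟩
    · rw [hq]
      have : 0 ≤ R := by linarith
      push_cast
      positivity
    · rw [QueryAlgorithm.qubits, hw]
      simp only [Nat.clog_one_right, zero_add, add_zero]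
      linarith
  · set u := √((k : ℝ) / (2 * n)) with hu
    have hu0 : 0 < u := Real.sqrt_pos.2 (by positivity)
    have hu1 : u ≤ 1 := Real.sqrt_le_one.2 (by rw [div_le_one (by positivity)]; linarith)
    have hlog4 : Real.log (4 / δ) = 2 * Real.log 2 + Real.log (1 / δ) := by
      rw [show (4 : ℝ) / δ = 2 ^ 2 * (1 / δ) by ring, Real.log_mul (by norm_num) (by positivity),
        Real.log_pow]
      norm_num
    -- The argument is at least 1, since `log (4 / δ) ≥ 3 * log 2 > 2 ≥ 2 * u`; rounding up to a
    -- power of 3 costs at most a factor 3.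
    obtain ⟨i, hi1, hi2⟩ := exists_three_pow_near (x := Real.log (4 / δ) / (2 * u)) (by
      rw [le_div_iff₀ (by positivity)]
      linarith)
    obtain ⟨alg, hsol, hq, hqb⟩ := exists_queryAlgorithm_of_pow n m k i δ hn hδ (by
      rw [div_le_iff₀ (by positivity)] at hi1
      linarith)
    refine ⟨alg, hsol, ?_, hqub _ ?_⟩
    · have hinv : 1 / u ≤ 2 * (√n / √k) := by
        rw [hu, Real.sqrt_div hk0.le, Real.sqrt_mul two_pos.le, one_div_div, ← mul_div_assoc]
        gcongr
        rw [Real.sqrt_le_left two_pos.le]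
        norm_num
      have hpow : (n : ℝ) ^ (3 / 2 : ℝ) = n * √n := by
        rw [Real.sqrt_eq_rpow, ← Real.rpow_one_add' hn0.le (by norm_num)]
        norm_num
      have h1 : (3 : ℝ) ^ i ≤ 9 * R * (√n / √k) := by
        calc (3 : ℝ) ^ i ≤ 3 * (Real.log (4 / δ) / (2 * u)) := hi2
          _ = (3 / 2 * Real.log (4 / δ)) * (1 / u) := by field_simp
          _ ≤ (3 / 2 * (3 * R)) * (2 * (√n / √k)) := by
            have h4 : Real.log (4 / δ) ≤ 3 * R := by linarith
            have h5 : 0 ≤ R := by linarith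
            gcongr
          _ = _ := by ring
      have h2 : (2 * n + 1 : ℝ) ≤ 3 * n := by
        have : (1 : ℝ) ≤ n := by exact_mod_cast hn
        linarith
      have hR0 : 0 ≤ R := by linarith
      have h3 : 0 ≤ R * (√n / √k) * n := by positivity
      rw [hq, hpow]
      push_cast
      calc (3 : ℝ) ^ i * (2 * n + 1) ≤ 9 * R * (√n / √k) * (3 * n) := by gcongr
        _ ≤ 100 * (R * (√n / √k) * n) := by linarith
        _ = _ := by ring
    · have h1 : (alg.qubits : ℝ) ≤ 3 * Nat.clog 2 n + 2 * Nat.clog 2 m + 1 := by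
        exact_mod_cast hqb
      have h2 : Real.log 2 ≤ Real.log n := Real.log_le_log two_pos (by exact_mod_cast hn2)
      have h3 := mul_le_mul_of_nonneg_right h1 (show 0 ≤ Real.log 2 by linarith)
      linarith
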